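/- Let $\mathbb S^1=\mathbb R/\mathbb Z$. Let $\mathcal H^\infty$ be the space of orientation-preserving $C^\infty$ diffeomorphisms of $\mathbb S^1$ with the $C^\infty$ topology, i.e. the topology of the metric $$d_\infty(f,g)=\sum_{k\ge 1}\frac{d_k(f,g)}{2^k(1+d_k(f,g))},\qquad d_k(f,g)=\max\{\|f-g\|_k,\ \|f^{-1}-g^{-1}\|_k\},$$ where $\|f-g\|_k=\max_{0\le i\le k}\max_{x\in\mathbb S^1}|D^i(f-g)(x)|$. Let $\mathcal D$ be the collection of orientation-preserving circle homeomorphisms with some degree of regularity between Hölder and $C^\infty$; that is, $\mathcal D$ is any collection of orientation-preserving homeomorphisms of $\mathbb S^1$ that contains every orientation-preserving $C^\infty$ diffeomorphism and each of whose members is Hölder continuous for some exponent in $(0,1]$, which may depend on the member (for instance, all orientation-preserving Hölder homeomorphisms, or all orientation-preserving $C^k$ diffeomorphisms for some $k\in\{1,2,\dots\}\cup\{\infty\}$). Call $S,T\in\mathcal H^\infty$ $\mathcal D$-conjugate if $S=h\circ T\circ h^{-1}$ for some $h\in\mathcal D$. Then there is no complete numerical Borel invariant for $\mathcal D$-conjugacy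 on $\mathcal H^\infty$: there is no Borel function $\varphi:\mathcal H^\infty\to\mathbb R$ such that for all $S,T\in\mathcal H^\infty$, the diffeomorphisms $S$ and $T$ are $\mathcal D$-conjugate if and only if $\varphi(S)=\varphi(T)$. -/

import Mathlib

open scoped ContDiff NNReal

noncomputable section

/-- `F : ℝ → ℝ` is a lift of the circle map `f : ℝ/ℤ → ℝ/ℤ`: it is continuous, (strictly)
increasing, and `f ∘ π = π ∘ F` for the quotient map `π : ℝ → ℝ/ℤ`. -/
def IsLift (F : ℝ → ℝ) (f : UnitAddCircle → UnitAddCircle) : Prop :=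
  Continuous F ∧ StrictMono F ∧ ∀ x : ℝ, ((F x : ℝ) : UnitAddCircle) = f (x : UnitAddCircle)

/-- The orientation-preserving homeomorphisms of the circle, i.e. those with an increasing lift. -/
def orientationPreservingHomeos : Set (UnitAddCircle ≃ₜ UnitAddCircle) :=
  {f | ∃ F : ℝ → ℝ, IsLift F f}

/-- `f` has an increasing lift which is `C^∞` on `ℝ`. (Two lifts of the same map differ by an
integer constant, so the choice of the lift is immaterial.) -/
def HasSmoothLift (f : UnitAddCircle → UnitAddCircle) : Prop :=
  ∃ F : ℝ → ℝ, IsLift F f ∧ ContDiff ℝ ∞ F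

/-- The orientation-preserving `C^∞` diffeomorphisms of the circle, as a set of homeomorphisms:
the map and its inverse are both increasing and `C^∞`. -/
def smoothDiffeos : Set (UnitAddCircle ≃ₜ UnitAddCircle) :=
  {f | HasSmoothLift f ∧ HasSmoothLift f.symm}

/-- The orientation-preserving circle homeomorphisms that are Hölder continuous for some positive
exponent (no condition is put on the inverse). -/
def holderHomeos : Set (UnitAddCircle ≃ₜ UnitAddCircle) :=
  {f | f ∈ orientationPreservingHomeos ∧
    ∃ C r : ℝ≥0, 0 < r ∧ r ≤ 1 ∧ HolderWith C r (f : UnitAddCircle → UnitAddCircle)}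

/-- The space of orientation-preserving `C^∞` diffeomorphisms of the circle; it is a separate type
because it carries the `C^∞` topology defined below. -/
@[ext]
structure CircleDiffeo where
  /-- the underlying homeomorphism -/
  toHomeo : UnitAddCircle ≃ₜ UnitAddCircle
  /-- it is an orientation-preserving `C^∞` diffeomorphism -/
  smooth : toHomeo ∈ smoothDiffeos

namespace CircleDiffeo

/-- The inverse diffeomorphism. -/
def inv (f : CircleDiffeo) : CircleDiffeo :=
  ⟨f.toHomeo.symm, f.smooth.2, by simpa using f.smooth.1⟩

/-- A smooth increasing lift of `f`. -/
def lift (f : CircleDiffeo) : ℝ → ℝ := Classical.choose f.smooth.1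

/-- The maximum over the circle of `|D^i (f - g)|`. For `i = 0`, where `f - g` is a map into the
circle, the absolute value is the distance to `0` in `ℝ/ℤ`; for `i ≥ 1` the derivatives are
those of lifts, which are periodic and do not depend on the choice of the lifts. -/
def derivDist : ℕ → CircleDiffeo → CircleDiffeo → ℝ
  | 0, f, g => ⨆ x : UnitAddCircle, ‖f.toHomeo x - g.toHomeo x‖
  | i + 1, f, g => ⨆ x : ℝ, |iteratedDeriv (i + 1) f.lift x - iteratedDeriv (i + 1) g.lift x|

/-- The norm `‖f - g‖_k`, the maximum of `|D^i (f - g)|` over the circle and over `0 ≤ i ≤ k`. -/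
def normSub (k : ℕ) (f g : CircleDiffeo) : ℝ :=
  (Finset.range (k + 1)).sup' ⟨0, by simp⟩ fun i => derivDist i f g

/-- The `C^k` distance `d_k(f, g) = max {‖f - g‖_k, ‖f⁻¹ - g⁻¹‖_k}`. -/
def distK (k : ℕ) (f g : CircleDiffeo) : ℝ :=
  max (normSub k f g) (normSub k f.inv g.inv)

/-- The metric `d_∞(f, g) = ∑_{k ≥ 1} 2^{-k} d_k(f, g) / (1 + d_k(f, g))`. -/
def distInfty (f g : CircleDiffeo) : ℝ :=
  ∑' k : ℕ, distK (k + 1) f g / (2 ^ (k + 1) * (1 + distK (k + 1) f g))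

/-- The `C^∞` topology on the space of diffeomorphisms, which is the topology of the metric `d_∞`:
a set is open when it contains a `d_∞`-ball around each of its points. -/
instance : TopologicalSpace CircleDiffeo where
  IsOpen U := ∀ f ∈ U, ∃ ε > 0, ∀ g, distInfty f g < ε → g ∈ U
  isOpen_univ := fun _ _ => ⟨1, one_pos, fun _ _ => Set.mem_univ _⟩
  isOpen_inter := by
    rintro U V hU hV f ⟨hfU, hfV⟩
    obtain ⟨ε, hε, h⟩ := hU f hfU
    obtain ⟨δ, hδ, h'⟩ := hV f hfV
    exact ⟨min ε δ, lt_min hε hδ, fun g hg =>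
      ⟨h g (hg.trans_le (min_le_left _ _)), h' g (hg.trans_le (min_le_right _ _))⟩⟩
  isOpen_sUnion := by
    rintro 𝒰 h𝒰 f ⟨U, hU, hfU⟩
    obtain ⟨ε, hε, h⟩ := h𝒰 U hU f hfU
    exact ⟨ε, hε, fun g hg => ⟨U, hU, h g hg⟩⟩

/-- The Borel σ-algebra of the `C^∞` topology. -/
instance : MeasurableSpace CircleDiffeo := borel CircleDiffeo

instance : BorelSpace CircleDiffeo := ⟨rfl⟩

/-- `S` and `T` are `𝒟`-conjugate: `S = h ∘ T ∘ h⁻¹` for some `h ∈ 𝒟`. -/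
def AreConjugate (𝒟 : Set (UnitAddCircle ≃ₜ UnitAddCircle)) (S T : CircleDiffeo) : Prop :=
  ∃ h ∈ 𝒟, ∀ x : UnitAddCircle, S.toHomeo x = h (T.toHomeo (h.symm x))

end CircleDiffeo

/-- `φ` is a complete numerical Borel invariant for `𝒟`-conjugacy of orientation-preserving `C^∞`
diffeomorphisms of the circle: a Borel function with `S`, `T` being `𝒟`-conjugate
if and only if `φ S = φ T`. -/
def IsCompleteBorelInvariant (𝒟 : Set (UnitAddCircle ≃ₜ UnitAddCircle))
    (φ : CircleDiffeo → ℝ) : Prop :=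
  Measurable φ ∧ ∀ S T : CircleDiffeo, CircleDiffeo.AreConjugate 𝒟 S T ↔ φ S = φ T

end

/-! Each point x of the Cantor group `ℕ → ZMod 2` is coded by a diffeomorphism F x. On the n-th of
the disjoint intervals (1/(n+2), 1/(n+1)) it acts as f n (x n), where f n 0 and f n 1 are conjugate
by a smooth H n supported there. Each of the two moves the points of a single arc, and the arcs have
diameters e (2n) and e (2n+1) for a sequence e that decreases superexponentially. Closeness of the
blocks to the identity makes F x smooth and x ↦ F x continuous (`exists_blocks`, `exists_glue`,
`continuous_toDiffeo_glue`).

Changing one coordinate conjugates F x by H n or its inverse (`glue_add_single`). A complete Borel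
invariant would thus give a Borel function of x that ignores finite changes; by ergodicity it is
almost everywhere constant, so it agrees at some x and its complement x + 1
(`exists_apply_add_one_eq`).

Yet F x and F (x + 1) are not Hölder conjugate (`not_areConjugate_add_one`). A conjugacy matches the
moved arcs, and a Hölder map cannot send a far smaller arc onto a larger one. Counting then forces
some arc n with x n = 1, of diameter e (2n+1), onto the arc of diameter e (2n), which is too large
(`not_holder_matching`). -/

open scoped ContDiff NNReal

open Filter Topology

/-! ### Ergodicity on the Cantor group -/

open MeasureTheory in
/-- A measurable function on the Cantor group that is invariant under changing any single
coordinate takes the same value at some point and at the complementary point. -/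
theorem exists_apply_add_one_eq {f : (ℕ → ZMod 2) → ℝ} (hf : Measurable f)
    (hinv : ∀ n x, f (x + Pi.single n 1) = f x) : ∃ x, f (x + 1) = f x := by
  let μ : Measure (ℕ → ZMod 2) := Measure.addHaar
  have hsupp : Dense {g : ℕ → ZMod 2 | ∀ x, f (g + x) = f x} := by
    let H : AddSubgroup (ℕ → ZMod 2) :=
      { carrier := {g | ∀ x, f (g + x) = f x}
        zero_mem' := by simp
        add_mem' := fun {a b} ha hb x => by rw [add_assoc, ha, hb]
        neg_mem' := fun {a} ha x => by rw [← ha (-a + x), add_neg_cancel_left] }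
    have hsingle : ∀ n (c : ZMod 2), Pi.single n c ∈ H := by
      intro n c
      have h1 : (Pi.single n 1 : ℕ → ZMod 2) ∈ H := fun x => by rw [add_comm, hinv]
      fin_cases c
      · have : (Pi.single n 0 : ℕ → ZMod 2) = 0 := Pi.single_zero n
        exact this ▸ H.zero_mem
      · exact h1
    -- Finitely supported sequences lie in `H`, and truncations of x converge to x.
    intro x
    have hx : Tendsto (fun N => ∑ n ∈ Finset.range N, (Pi.single n (x n) : ℕ → ZMod 2)) atTop
        (𝓝 x) := by
      rw [tendsto_pi_nhds]
      intro m
      refine tendsto_const_nhds.congr' ?_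
      filter_upwards [eventually_gt_atTop m] with N hN
      rw [Finset.sum_apply, Finset.sum_eq_single m]
      · simp
      · intro b _ hb
        simp [hb.symm]
      · intro h
        exact absurd (Finset.mem_range.2 hN) h
    exact mem_closure_of_tendsto hx
      (Eventually.of_forall fun N => H.sum_mem fun n _ => hsingle n (x n))
  have hconst : ∀ a : ℝ, EventuallyConst {x | f x < a} (ae μ) := by
    intro a
    refine aeconst_of_dense_setOfPred_preimage_vadd_eq (M := ℕ → ZMod 2)
      (measurableSet_lt hf measurable_const).nullMeasurableSet (hsupp.mono ?_)
    intro g hg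
    ext x
    simp only [Set.mem_preimage, Set.mem_ofPred_eq, vadd_eq_add]
    rw [hg x]
  -- Each sublevel set is null or conull and translation by 1 preserves the measure; countably many
  -- rational thresholds determine the value.
  have hall : ∀ᵐ x ∂μ, ∀ q : ℚ, (f (1 + x) < q ↔ f x < q) := by
    rw [ae_all_iff]
    intro q
    have hq : MeasurePreserving (fun x : ℕ → ZMod 2 => 1 + x) μ μ := measurePreserving_add_left μ 1
    rcases eventuallyConst_set.1 (hconst q) with h | h
    · filter_upwards [h, hq.quasiMeasurePreserving.ae h] with x h1 h2
      exact iff_of_true h2 h1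
    · filter_upwards [h, hq.quasiMeasurePreserving.ae h] with x h1 h2
      exact iff_of_false h2 h1
  obtain ⟨x, hx⟩ := hall.exists
  refine ⟨x, ?_⟩
  rw [add_comm]
  rcases lt_trichotomy (f (1 + x)) (f x) with h | h | h
  · obtain ⟨q, hq1, hq2⟩ := exists_rat_btwn h
    exact absurd ((hx q).1 hq1) (not_lt.2 hq2.le)
  · exact h
  · obtain ⟨q, hq1, hq2⟩ := exists_rat_btwn h
    exact absurd ((hx q).2 hq1) (not_lt.2 hq2.le)

/-! ### Superexponentially decreasing sequences -/

/-- Positive double sequences with rows tending to zero admit a choice of one entry in each row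
such that the chosen entries decrease faster than all powers. -/
theorem exists_superexponential_choice {D : ℕ → ℕ → ℝ} (hpos : ∀ j k, 0 < D j k)
    (hlim : ∀ j, Filter.Tendsto (D j) Filter.atTop (nhds 0)) :
    ∃ K : ℕ → ℕ, D 0 (K 0) ≤ 1 / 2 ∧ ∀ j, D (j + 1) (K (j + 1)) ≤ D j (K j) ^ (j + 1) := by
  have key : ∀ j, ∀ ε > 0, ∃ k, D j k ≤ ε := fun j ε hε =>
    ((hlim j).eventually_le_const hε).exists
  choose k hk using key
  let K : ℕ → ℕ := fun n => Nat.rec (k 0 (1 / 2) (by norm_num))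
    (fun j kj => k (j + 1) (D j kj ^ (j + 1)) (pow_pos (hpos _ _) _)) n
  exact ⟨K, hk 0 _ _, fun j => hk (j + 1) _ _⟩

/-- Since e is antitone, e j ≤ e (j - 1) ^ j ≤ e i ^ j. The exponent j grows without bound, so it
eventually beats any fixed Hölder exponent. -/
theorem superexponential_le_pow {e : ℕ → ℝ} (hpos : ∀ j, 0 < e j) (h0 : e 0 ≤ 1 / 2)
    (hstep : ∀ j, e (j + 1) ≤ e j ^ (j + 1)) : (∀ j, e j ≤ 1 / 2) ∧ ∀ i j, i < j → e j ≤ e i ^ j := by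
  have hhalf : ∀ j, e j ≤ 1 / 2 := by
    intro j
    induction j with
    | zero => exact h0
    | succ j ih =>
      refine (hstep j).trans ((pow_le_of_le_one (hpos j).le (by linarith) (by simp)).trans ih)
  have hanti : Antitone e := antitone_nat_of_succ_le fun j =>
    (hstep j).trans (pow_le_of_le_one (hpos j).le (by linarith [hhalf j]) (by simp))
  refine ⟨hhalf, fun i j hij => ?_⟩
  obtain ⟨k, rfl⟩ : ∃ k, j = k + 1 := ⟨j - 1, by omega⟩
  exact (hstep k).trans (pow_le_pow_left₀ (hpos k).le (hanti (by omega)) _)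

/-- A superexponentially decreasing sequence is Hölder separated. -/
theorem superexponential_separated {e : ℕ → ℝ} (hpos : ∀ j, 0 < e j) (h0 : e 0 ≤ 1 / 2)
    (hstep : ∀ j, e (j + 1) ≤ e j ^ (j + 1)) (C r : ℝ) (hr : 0 < r) :
    ∃ N, ∀ i j, i < j → N ≤ j → C * e j ^ r < e i := by
  obtain ⟨hhalf, hpow⟩ := superexponential_le_pow hpos h0 hstep
  have hlim : Filter.Tendsto (fun j : ℕ => (|C| * 2) * ((1 / 2 : ℝ) ^ r) ^ j) Filter.atTop
      (nhds ((|C| * 2) * 0)) := by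
    refine (tendsto_pow_atTop_nhds_zero_of_lt_one (by positivity) ?_).const_mul _
    exact Real.rpow_lt_one (by norm_num) (by norm_num) hr
  rw [mul_zero] at hlim
  obtain ⟨M, hM⟩ := exists_nat_gt (1 / r)
  obtain ⟨N, hN⟩ := Filter.eventually_atTop.1
    ((hlim.eventually_lt_const one_pos).and (Filter.eventually_ge_atTop M))
  refine ⟨N, fun i j hij hj => ?_⟩
  obtain ⟨h1, h2⟩ := hN j hj
  have hjr : 1 < j * r := by
    have : (M : ℝ) ≤ j := by exact_mod_cast h2
    rw [div_lt_iff₀ hr] at hM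
    nlinarith
  have e1 : e j ^ r ≤ e i ^ ((j : ℝ) * r) := by
    rw [Real.rpow_mul (hpos i).le, Real.rpow_natCast]
    exact Real.rpow_le_rpow (hpos j).le (hpow i j hij) hr.le
  -- One factor e i is split off; the remaining power is at most 2 · 2 ^ (-jr), which absorbs C once
  -- j is large.
  have e2 : e i ^ ((j : ℝ) * r) = e i * e i ^ ((j : ℝ) * r - 1) := by
    rw [Real.rpow_sub (hpos i), Real.rpow_one]
    field_simp [(hpos i).ne']
  have e3 : e i ^ ((j : ℝ) * r - 1) ≤ (1 / 2 : ℝ) ^ ((j : ℝ) * r - 1) :=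
    Real.rpow_le_rpow (hpos i).le (hhalf i) (by linarith)
  have e4 : (1 / 2 : ℝ) ^ ((j : ℝ) * r - 1) = 2 * ((1 / 2 : ℝ) ^ r) ^ j := by
    rw [Real.rpow_sub (by norm_num), Real.rpow_one, mul_comm (j : ℝ) r, Real.rpow_mul (by norm_num),
      Real.rpow_natCast]
    ring
  have hpi := hpos i
  calc C * e j ^ r ≤ |C| * e j ^ r := by
        gcongr
        · exact Real.rpow_nonneg (hpos j).le r
        · exact le_abs_self C
    _ ≤ |C| * (e i * (2 * ((1 / 2 : ℝ) ^ r) ^ j)) := by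
        rw [← e4]
        gcongr
        rw [e2] at e1
        exact e1.trans (by gcongr)
    _ = e i * ((|C| * 2) * ((1 / 2 : ℝ) ^ r) ^ j) := by ring
    _ < e i * 1 := by gcongr
    _ = e i := mul_one _

/-- A matching between two complementary selections from a superexponentially decreasing sequence
cannot be Hölder. -/
theorem not_holder_matching {e : ℕ → ℝ} (hpos : ∀ j, 0 < e j) (h0 : e 0 ≤ 1 / 2)
    (hstep : ∀ j, e (j + 1) ≤ e j ^ (j + 1)) {x : ℕ → ZMod 2} (hx : ∃ᶠ n in Filter.atTop, x n = 1)
    {τ : ℕ → ℕ} (hτ : Function.Injective τ) (C r : ℝ) (hr : 0 < r)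
    (h : ∀ m, e (2 * m + (x m + 1).val) ≤ C * e (2 * τ m + (x (τ m)).val) ^ r) : False := by
  obtain ⟨N, hN⟩ := superexponential_separated hpos h0 hstep C r hr
  -- An arc can be mapped onto the m-th target only if its index is not larger, except among the
  -- first N indices.
  have key : ∀ m, 2 * τ m + (x (τ m)).val < N ∨
      2 * τ m + (x (τ m)).val ≤ 2 * m + (x m + 1).val := by
    intro m
    by_contra! hcon
    exact absurd (h m) (not_le.2 (hN _ _ hcon.2 hcon.1))
  have hval : ∀ c : ZMod 2, c.val < 2 := fun c => ZMod.val_lt c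
  obtain ⟨n, hn, hxn⟩ := (hx.and_eventually (Filter.eventually_ge_atTop N)).exists.imp
    fun n hn => And.intro hn.2 hn.1
  -- As n ≥ N, the index bound gives τ m ≤ n for m ≤ n. An injective self-map of {0, …, n} is onto,
  -- so n is attained.
  have hmaps : Set.MapsTo τ (Finset.range (n + 1) : Finset ℕ) (Finset.range (n + 1) : Finset ℕ) := by
    intro m hm
    simp only [Finset.coe_range, Set.mem_Iio] at hm ⊢
    have := hval (x m + 1)
    rcases key m with h | h <;> omega
  have hsurj := Finset.surjOn_of_injOn_of_card_le τ hmaps hτ.injOn le_rfl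
  obtain ⟨m, hm, hmn⟩ := hsurj (show n ∈ ((Finset.range (n + 1) : Finset ℕ) : Set ℕ) by simp)
  simp only [Finset.coe_range, Set.mem_Iio] at hm
  have hk := key m
  have h1 : (1 : ZMod 2).val = 1 := rfl
  rw [hmn, hxn, h1] at hk
  have := hval (x m + 1)
  -- From 2n + 1 ≤ 2m + (0 or 1) and m ≤ n. Then x n = 1 turns the bound into 2n + 1 ≤ 2n.
  have hmn' : m = n := by omega
  subst hmn'
  rw [hxn] at hk
  have h2 : (1 + 1 : ZMod 2).val = 0 := rfl
  omega

/-! ### Lifts of circle diffeomorphisms -/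

/-- The smooth diffeomorphisms of the line that commute with the translation by one. -/
def liftSubgroup : Subgroup (ℝ ≃o ℝ) where
  carrier := {f | ContDiff ℝ ∞ f ∧ ContDiff ℝ ∞ f.symm ∧ ∀ t, f (t + 1) = f t + 1}
  mul_mem' := fun {f g} hf hg => ⟨hf.1.comp hg.1, hg.2.1.comp hf.2.1, fun t => by
    simp [hf.2.2, hg.2.2]⟩
  one_mem' := ⟨contDiff_id, contDiff_id, fun _ => rfl⟩
  inv_mem' := fun {f} hf => ⟨hf.2.1, hf.1, fun t => by
    change f.symm (t + 1) = f.symm t + 1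
    rw [OrderIso.symm_apply_eq, hf.2.2, OrderIso.apply_symm_apply]⟩

/-- The group of lifts of smooth circle diffeomorphisms. -/
abbrev LiftGroup : Type := liftSubgroup

namespace LiftGroup

instance : CoeFun LiftGroup fun _ => ℝ → ℝ := ⟨fun f => f.1⟩

theorem contDiff (f : LiftGroup) : ContDiff ℝ ∞ f := f.2.1

theorem map_add_one (f : LiftGroup) (t : ℝ) : f (t + 1) = f t + 1 := f.2.2.2 t

theorem strictMono (f : LiftGroup) : StrictMono f := f.1.strictMono

@[simp] theorem mul_apply (f g : LiftGroup) (t : ℝ) : (f * g) t = f (g t) := rfl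

@[simp] theorem inv_apply_self (f : LiftGroup) (t : ℝ) : f⁻¹ (f t) = t := f.1.symm_apply_apply t

@[simp] theorem apply_inv_self (f : LiftGroup) (t : ℝ) : f (f⁻¹ t) = t := f.1.apply_symm_apply t

theorem map_add_int (f : LiftGroup) (t : ℝ) (n : ℤ) : f (t + n) = f t + n := by
  induction n with
  | zero => simp
  | succ n ih => push_cast at ih ⊢; rw [← add_assoc, map_add_one, ih, add_assoc]
  | pred n ih =>
    have := f.map_add_one (t + ((-n - 1 : ℤ) : ℝ))
    push_cast at this ih ⊢
    rw [show t + (-(n : ℝ) - 1) + 1 = t + -(n : ℝ) by ring, ih] at this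
    linarith

/-- Bijectivity, smoothness and commutation with the translation imply monotonicity. -/
theorem exists_of_inverse {F G : ℝ → ℝ} (hF : ContDiff ℝ ∞ F) (hG : ContDiff ℝ ∞ G)
    (hGF : ∀ t, G (F t) = t) (hFG : ∀ t, F (G t) = t) (h1 : ∀ t, F (t + 1) = F t + 1) :
    ∃ f : LiftGroup, (∀ t, f t = F t) ∧ ∀ t, f⁻¹ t = G t := by
  have hmono : StrictMono F := by
    rcases hF.continuous.strictMono_of_inj (Function.LeftInverse.injective hGF) with h | h
    · exact h
    · have := h (show (0 : ℝ) < 0 + 1 by norm_num)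
      rw [h1] at this
      linarith
  let e : ℝ ≃o ℝ :=
    { toFun := F, invFun := G, left_inv := hGF, right_inv := hFG
      map_rel_iff' := hmono.le_iff_le }
  exact ⟨⟨e, hF, hG, h1⟩, fun _ => rfl, fun _ => rfl⟩

theorem coe_periodic (f : LiftGroup) : Function.Periodic (fun t => (f t : UnitAddCircle)) 1 := by
  intro t
  simp [map_add_one]

/-- The circle homeomorphism covered by a lift. -/
def toHomeo (f : LiftGroup) : UnitAddCircle ≃ₜ UnitAddCircle where
  toFun := f.coe_periodic.lift
  invFun := f⁻¹.coe_periodic.lift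
  left_inv p := by
    induction p using QuotientAddGroup.induction_on with
    | H t => simp only [Function.Periodic.lift_coe, inv_apply_self]
  right_inv p := by
    induction p using QuotientAddGroup.induction_on with
    | H t => simp only [Function.Periodic.lift_coe, apply_inv_self]
  continuous_toFun := continuous_coinduced_dom.2
    ((AddCircle.continuous_mk' 1).comp f.contDiff.continuous)
  continuous_invFun := continuous_coinduced_dom.2
    ((AddCircle.continuous_mk' 1).comp f⁻¹.contDiff.continuous)

@[simp] theorem toHomeo_coe (f : LiftGroup) (t : ℝ) :
    f.toHomeo (t : UnitAddCircle) = (f t : UnitAddCircle) := rfl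

theorem isLift (f : LiftGroup) : IsLift f f.toHomeo :=
  ⟨f.contDiff.continuous, f.strictMono, fun _ => rfl⟩

theorem toHomeo_mem (f : LiftGroup) : f.toHomeo ∈ smoothDiffeos :=
  ⟨⟨_, f.isLift, f.contDiff⟩, ⟨_, f⁻¹.isLift, f⁻¹.contDiff⟩⟩

/-- The circle diffeomorphism covered by a lift. -/
def toDiffeo (f : LiftGroup) : CircleDiffeo := ⟨f.toHomeo, f.toHomeo_mem⟩

theorem inv_toDiffeo (f : LiftGroup) : f.toDiffeo.inv = f⁻¹.toDiffeo := by
  ext p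
  induction p using QuotientAddGroup.induction_on with
  | H t => rfl

/-- A lift that fixes an integer moves a point iff the circle map does. -/
theorem toHomeo_coe_eq_iff {f : LiftGroup} (h0 : f 0 = 0) (t : ℝ) :
    f.toHomeo (t : UnitAddCircle) = t ↔ f t = t := by
  refine ⟨fun h => ?_, fun h => by rw [toHomeo_coe, h]⟩
  have hint : ∀ n : ℤ, f n = n := fun n => by simpa [h0] using f.map_add_int 0 n
  rw [toHomeo_coe, eq_comm, QuotientAddGroup.eq_iff_sub_mem, AddSubgroup.mem_zmultiples_iff] at h
  obtain ⟨k, hk⟩ := h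
  simp only [zsmul_eq_mul, mul_one] at hk
  have h1 : (⌊t⌋ : ℝ) ≤ f t := by
    rw [← hint]
    exact f.strictMono.monotone (Int.floor_le t)
  have h2 : f t < ⌊t⌋ + 1 := by
    have : f t < f ((⌊t⌋ + 1 : ℤ) : ℝ) := f.strictMono (by push_cast; exact Int.lt_floor_add_one t)
    rw [hint] at this
    exact_mod_cast this
  have h3 := Int.floor_le t
  have h4 := Int.lt_floor_add_one t
  -- Both t and f t lie in [⌊t⌋, ⌊t⌋ + 1), so their integer difference vanishes.
  have hk1 : (k : ℝ) < 1 := by linarith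
  have hk2 : (-1 : ℝ) < k := by linarith
  have : k = 0 := by
    have : k < 1 := by exact_mod_cast hk1
    have : -1 < k := by exact_mod_cast hk2
    omega
  rw [this] at hk
  simp at hk
  linarith

end LiftGroup

/-- Two lifts of the same circle map differ by a constant. -/
theorem IsLift.exists_eq_add_const {F G : ℝ → ℝ} {f : UnitAddCircle → UnitAddCircle}
    (hF : IsLift F f) (hG : IsLift G f) : ∃ c, F = fun t => G t + c := by
  have hint : ∀ t, ∃ n : ℤ, (n : ℝ) = F t - G t := by
    intro t
    have h : (F t : UnitAddCircle) = G t := (hF.2.2 t).trans (hG.2.2 t).symm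
    rw [QuotientAddGroup.eq_iff_sub_mem, AddSubgroup.mem_zmultiples_iff] at h
    obtain ⟨k, hk⟩ := h
    exact ⟨k, by simpa using hk⟩
  choose n hn using hint
  have hcont : Continuous n := by
    rw [Int.isClosedEmbedding_coe_real.isEmbedding.continuous_iff]
    have : ((fun k : ℤ => (k : ℝ)) ∘ n) = fun t => F t - G t := funext hn
    rw [show (Int.cast ∘ n : ℝ → ℝ) = fun t => F t - G t from this]
    exact hF.1.sub hG.1
  refine ⟨n 0, funext fun t => ?_⟩
  have := PreconnectedSpace.constant inferInstance hcont (x := t) (y := 0)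
  rw [← this, hn]
  ring

/-! ### Distances of lifts and the `C^∞` topology -/

namespace LiftGroup

/-- The chosen lift of the circle map differs from f by a constant, which disappears after one
derivative. -/
theorem iteratedDeriv_lift (f : LiftGroup) (i : ℕ) :
    iteratedDeriv (i + 1) f.toDiffeo.lift = iteratedDeriv (i + 1) f := by
  obtain ⟨c, hc⟩ := (Classical.choose_spec f.toDiffeo.smooth.1).1.exists_eq_add_const f.isLift
  have hc' : f.toDiffeo.lift = fun t => f t + c := hc
  rw [iteratedDeriv_succ', iteratedDeriv_succ', hc']
  congr 1
  ext t
  simp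

theorem derivDist_le {f g : LiftGroup} {i : ℕ} {δ : ℝ}
    (h : ∀ t, |iteratedDeriv i (fun s => f s - g s) t| ≤ δ) :
    CircleDiffeo.derivDist i f.toDiffeo g.toDiffeo ≤ δ := by
  cases i with
  | zero =>
    refine ciSup_le fun p => ?_
    induction p using QuotientAddGroup.induction_on with
    | H t =>
      have := h t
      simp only [iteratedDeriv_zero] at this
      change ‖((f t : ℝ) : UnitAddCircle) - (g t : ℝ)‖ ≤ δ
      rw [← AddCircle.coe_sub]
      exact (QuotientAddGroup.norm_mk_le_norm).trans this
  | succ i =>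
    refine ciSup_le fun t => ?_
    rw [iteratedDeriv_lift, iteratedDeriv_lift]
    have := h t
    have hf : ContDiffAt ℝ ((i + 1 : ℕ) : WithTop ℕ∞) f t :=
      (f.contDiff.of_le (by exact_mod_cast le_top)).contDiffAt
    have hg : ContDiffAt ℝ ((i + 1 : ℕ) : WithTop ℕ∞) g t :=
      (g.contDiff.of_le (by exact_mod_cast le_top)).contDiffAt
    rwa [iteratedDeriv_fun_sub hf hg] at this

end LiftGroup

namespace CircleDiffeo

theorem derivDist_nonneg (i : ℕ) (f g : CircleDiffeo) : 0 ≤ derivDist i f g := by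
  cases i with
  | zero => exact Real.iSup_nonneg fun _ => norm_nonneg _
  | succ i => exact Real.iSup_nonneg fun _ => abs_nonneg _

theorem distK_nonneg (k : ℕ) (f g : CircleDiffeo) : 0 ≤ distK k f g :=
  le_max_of_le_left ((derivDist_nonneg 0 f g).trans
    (Finset.le_sup' (fun i => derivDist i f g) (by simp)))

theorem distK_le {k : ℕ} {f g : CircleDiffeo} {δ : ℝ} (h : ∀ i ≤ k, derivDist i f g ≤ δ)
    (h' : ∀ i ≤ k, derivDist i f.inv g.inv ≤ δ) : distK k f g ≤ δ :=
  max_le (Finset.sup'_le _ _ fun i hi => h i (Nat.lt_succ_iff.1 (Finset.mem_range.1 hi)))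
    (Finset.sup'_le _ _ fun i hi => h' i (Nat.lt_succ_iff.1 (Finset.mem_range.1 hi)))

theorem tendsto_distInfty {ι : Type*} {l : Filter ι} (f : CircleDiffeo) {g : ι → CircleDiffeo}
    (h : ∀ k, Tendsto (fun a => distK k f (g a)) l (𝓝 0)) :
    Tendsto (fun a => distInfty f (g a)) l (𝓝 0) := by
  have key := tendsto_tsum_of_dominated_convergence (𝓕 := l)
    (f := fun a (k : ℕ) => distK (k + 1) f (g a) / (2 ^ (k + 1) * (1 + distK (k + 1) f (g a))))
    (g := fun _ => 0) (bound := fun k : ℕ => (1 / 2 : ℝ) ^ (k + 1))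
    ((summable_nat_add_iff 1).2 summable_geometric_two) ?_ ?_
  · simpa [distInfty] using key
  · intro k
    have h1 := h (k + 1)
    have := h1.div ((h1.const_add 1).const_mul (2 ^ (k + 1))) (by simp)
    simpa [Pi.div_def] using this
  · refine Eventually.of_forall fun a k => ?_
    have hd := distK_nonneg (k + 1) f (g a)
    rw [Real.norm_of_nonneg (by positivity), div_le_iff₀ (by positivity), ← mul_assoc,
      ← mul_pow]
    norm_num

/-- Continuity for the `C^∞` topology is implied by smallness of all the `C^k` distances. -/
theorem continuous_of_tendsto_distK {X : Type*} [TopologicalSpace X] {Φ : X → CircleDiffeo}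
    (h : ∀ x k, Tendsto (fun y => distK k (Φ x) (Φ y)) (𝓝 x) (𝓝 0)) : Continuous Φ := by
  refine ⟨fun U hU => isOpen_iff_mem_nhds.2 fun x hx => ?_⟩
  obtain ⟨ε, hε, hball⟩ := hU (Φ x) hx
  filter_upwards [(tendsto_distInfty (Φ x) (h x)).eventually_lt_const hε] with y hy
  exact hball _ hy

end CircleDiffeo

/-! ### Gluing diffeomorphisms with disjoint supports -/

namespace LiftGroup

/-- All derivatives up to order `n` of the displacement of `f` are bounded by `2⁻ⁿ`. -/
def NearOne (n : ℕ) (f : LiftGroup) : Prop :=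
  ∀ k ≤ n, ∀ t, |iteratedDeriv k (fun s => f s - s) t| ≤ (1 / 2 : ℝ) ^ n

theorem contDiff_displacement (f : LiftGroup) : ContDiff ℝ ∞ fun s => f s - s :=
  f.contDiff.sub contDiff_id

theorem iteratedDeriv_sub_le {n : ℕ} {f g : LiftGroup} (hf : NearOne n f) (hg : NearOne n g)
    {k : ℕ} (hk : k ≤ n) (t : ℝ) :
    |iteratedDeriv k (fun s => f s - g s) t| ≤ 2 * (1 / 2 : ℝ) ^ n := by
  have h1 : ContDiffAt ℝ (k : WithTop ℕ∞) (fun s => f s - s) t :=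
    (f.contDiff_displacement.of_le (by exact_mod_cast le_top)).contDiffAt
  have h2 : ContDiffAt ℝ (k : WithTop ℕ∞) (fun s => g s - s) t :=
    (g.contDiff_displacement.of_le (by exact_mod_cast le_top)).contDiffAt
  have h3 : (fun s => f s - g s) = fun s => (f s - s) - (g s - s) := by
    ext s
    ring
  rw [h3, iteratedDeriv_fun_sub h1 h2, two_mul]
  exact (abs_sub _ _).trans (add_le_add (hf k hk t) (hg k hk t))

/-- The map acting as `f n` on the support of `f n`, for diffeomorphisms with disjoint supports. -/
noncomputable def glueFun (f : ℕ → LiftGroup) (t : ℝ) : ℝ := t + ∑' n, (f n t - t)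

section

variable {A : ℕ → Set ℝ} {f g : ℕ → LiftGroup}

/-- Each `f n` is supported in `A n`. -/
def SupportedIn (A : ℕ → Set ℝ) (f : ℕ → LiftGroup) : Prop := ∀ n, ∀ t ∉ A n, f n t = t

theorem SupportedIn.inv (hf : SupportedIn A f) : SupportedIn A fun n => (f n)⁻¹ := by
  intro n t ht
  have := hf n t ht
  calc (f n)⁻¹ t = (f n)⁻¹ (f n t) := by rw [this]
    _ = t := inv_apply_self _ _

/-- If the image were outside A n it would be fixed, and injectivity would make it equal to t. -/
theorem SupportedIn.map_mem (hf : SupportedIn A f) {n : ℕ} {t : ℝ} (ht : t ∈ A n) :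
    f n t ∈ A n := by
  by_contra h
  have := hf n _ h
  rw [(f n).strictMono.injective this] at h
  exact h ht

theorem SupportedIn.displacement_eq_zero (hf : SupportedIn A f)
    (hA : Pairwise (Function.onFun Disjoint A)) {n m : ℕ} {t : ℝ} (ht : t ∈ A n)
    (hm : m ≠ n) : f m t - t = 0 :=
  sub_eq_zero.2 (hf m t fun h => Set.disjoint_left.1 (hA hm) h ht)

theorem SupportedIn.glueFun_of_mem (hf : SupportedIn A f)
    (hA : Pairwise (Function.onFun Disjoint A)) {n : ℕ} {t : ℝ} (ht : t ∈ A n) :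
    glueFun f t = f n t := by
  rw [glueFun, tsum_eq_single n fun m hm => hf.displacement_eq_zero hA ht hm]
  ring

theorem SupportedIn.glueFun_of_notMem (hf : SupportedIn A f) {t : ℝ} (ht : ∀ n, t ∉ A n) :
    glueFun f t = t := by
  have : ∀ n, f n t - t = 0 := fun n => sub_eq_zero.2 (hf n t (ht n))
  simp [glueFun, this]

theorem SupportedIn.summable (hf : SupportedIn A f)
    (hA : Pairwise (Function.onFun Disjoint A)) (t : ℝ) : Summable fun n => f n t - t := by
  by_cases h : ∃ n, t ∈ A n
  · obtain ⟨n, hn⟩ := h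
    exact (hasSum_single n fun m hm => hf.displacement_eq_zero hA hn hm).summable
  · push Not at h
    have : (fun n => f n t - t) = fun _ => 0 := funext fun n => sub_eq_zero.2 (hf n t (h n))
    rw [this]
    exact summable_zero

theorem SupportedIn.glueFun_glueFun_inv (hf : SupportedIn A f)
    (hA : Pairwise (Function.onFun Disjoint A)) (t : ℝ) :
    glueFun f (glueFun (fun n => (f n)⁻¹) t) = t := by
  by_cases h : ∃ n, t ∈ A n
  · obtain ⟨n, hn⟩ := h
    rw [hf.inv.glueFun_of_mem hA hn, hf.glueFun_of_mem hA (hf.inv.map_mem hn), apply_inv_self]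
  · push Not at h
    rw [hf.inv.glueFun_of_notMem h, hf.glueFun_of_notMem h]

/-- For each k, all but finitely many terms have k-th derivative at most 2⁻ⁿ, so the series
converges in every C^k. -/
theorem contDiff_glueFun (hf : ∀ n, NearOne n (f n)) : ContDiff ℝ ∞ (glueFun f) := by
  refine contDiff_id.add (contDiff_tsum_of_eventually (v := fun _ n => (1 / 2 : ℝ) ^ n)
    (fun n => (f n).contDiff_displacement) (fun _ _ => summable_geometric_two) fun k _ => ?_)
  rw [Nat.cofinite_eq_atTop]
  filter_upwards [eventually_ge_atTop k] with n hn t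
  rw [norm_iteratedFDeriv_eq_norm_iteratedDeriv]
  exact hf n k hn t

theorem exists_glue (hf : SupportedIn A f)
    (hA : Pairwise (Function.onFun Disjoint A)) (hn : ∀ n, NearOne n (f n))
    (hn' : ∀ n, NearOne n (f n)⁻¹) : ∃ F : LiftGroup, (∀ t, F t = glueFun f t) ∧
      ∀ t, F⁻¹ t = glueFun (fun n => (f n)⁻¹) t := by
  refine exists_of_inverse (contDiff_glueFun hn) (contDiff_glueFun hn') (fun t => ?_)
    (hf.glueFun_glueFun_inv hA) (fun t => ?_)
  · simpa using hf.inv.glueFun_glueFun_inv hA t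
  · simp only [glueFun, map_add_one, add_sub_add_right_eq_sub]
    ring

/-- The first N terms cancel; the tail is bounded by the sum of 2 · 2⁻ⁿ over n ≥ N. -/
theorem iteratedDeriv_glueFun_sub_le (hf : SupportedIn A f)
    (hA : Pairwise (Function.onFun Disjoint A)) (hg : SupportedIn A g)
    (hnf : ∀ n, NearOne n (f n)) (hng : ∀ n, NearOne n (g n)) {N : ℕ}
    (hfg : ∀ n < N, f n = g n) {k : ℕ} (hk : k ≤ N) (t : ℝ) :
    |iteratedDeriv k (fun s => glueFun f s - glueFun g s) t| ≤ 4 * (1 / 2 : ℝ) ^ N := by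
  have hsum : HasSum (fun m => 2 * (1 / 2 : ℝ) ^ (m + N)) (4 * (1 / 2 : ℝ) ^ N) := by
    have := (hasSum_geometric_two.mul_left (2 * (1 / 2 : ℝ) ^ N))
    rw [show (4 : ℝ) * (1 / 2) ^ N = 2 * (1 / 2) ^ N * 2 by ring]
    refine this.congr_fun fun m => ?_
    rw [pow_add]
    ring
  have heq : (fun s => glueFun f s - glueFun g s) =
      fun s => ∑' m, (f (m + N) s - g (m + N) s) := by
    ext s
    have hs := (hf.summable hA s).sub (hg.summable hA s)
    rw [glueFun, glueFun, add_sub_add_left_eq_sub, ← (hf.summable hA s).tsum_sub (hg.summable hA s),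
      ← hs.sum_add_tsum_nat_add N, Finset.sum_eq_zero, zero_add]
    · simp
    · intro n hn
      rw [hfg n (Finset.mem_range.1 hn)]
      simp
  have hbound : ∀ (i m : ℕ) (s : ℝ), (i : ℕ∞) ≤ (k : ℕ∞) →
      ‖iteratedFDeriv ℝ i (fun s => f (m + N) s - g (m + N) s) s‖ ≤
        2 * (1 / 2 : ℝ) ^ (m + N) := by
    intro i m s hi
    have hi' : i ≤ k := by exact_mod_cast hi
    rw [norm_iteratedFDeriv_eq_norm_iteratedDeriv]
    exact iteratedDeriv_sub_le (hnf _) (hng _) (by omega) s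
  rw [← Real.norm_eq_abs, ← norm_iteratedFDeriv_eq_norm_iteratedDeriv, heq,
    iteratedFDeriv_tsum (N := (k : ℕ∞)) (v := fun _ m => 2 * (1 / 2 : ℝ) ^ (m + N))
      (fun m => ((f (m + N)).contDiff.sub (g (m + N)).contDiff).of_le (by exact_mod_cast le_top))
      (fun _ _ => hsum.summable) hbound le_rfl]
  exact tsum_of_norm_bounded hsum fun m => hbound k m t le_rfl

end

end LiftGroup

/-! ### Bump functions and smooth families near the identity -/

/-- A smooth `1`-periodic function that vanishes exactly off the translates of `(l, r)`. -/
noncomputable def periodicBump (l r t : ℝ) : ℝ :=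
  expNegInvGlue (Real.sin (Real.pi * (t - l)) * Real.sin (Real.pi * (r - t)))

theorem contDiff_periodicBump (l r : ℝ) : ContDiff ℝ ∞ (periodicBump l r) := by
  have : ContDiff ℝ ∞ fun t => Real.sin (Real.pi * (t - l)) * Real.sin (Real.pi * (r - t)) := by
    fun_prop
  exact (expNegInvGlue.contDiff (n := ⊤)).comp this

theorem periodicBump_nonneg (l r t : ℝ) : 0 ≤ periodicBump l r t := expNegInvGlue.nonneg _

theorem periodic_periodicBump (l r : ℝ) : Function.Periodic (periodicBump l r) 1 := by
  intro t
  have h1 : Real.pi * (t + 1 - l) = Real.pi * (t - l) + Real.pi := by ring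
  have h2 : Real.pi * (r - (t + 1)) = Real.pi * (r - t) - Real.pi := by ring
  rw [periodicBump, h1, h2, Real.sin_add_pi, Real.sin_sub_pi, neg_mul_neg]
  rfl

theorem Function.Periodic.map_fract {α : Type*} {f : ℝ → α} (hf : Function.Periodic f 1) (t : ℝ) :
    f (Int.fract t) = f t := by
  rw [Int.fract]
  simpa using hf.sub_int_mul_eq (x := t) ⌊t⌋

theorem periodicBump_ne_zero_iff {l r : ℝ} (hl : 0 ≤ l) (hlr : l < r) (hr : r ≤ 1) (t : ℝ) :
    periodicBump l r t ≠ 0 ↔ Int.fract t ∈ Set.Ioo l r := by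
  rw [← (periodic_periodicBump l r).map_fract, periodicBump, Ne, expNegInvGlue.zero_iff_nonpos,
    not_le]
  have h0 := Int.fract_nonneg t
  have h1 := Int.fract_lt_one t
  generalize Int.fract t = s at *
  have hpi := Real.pi_pos
  constructor
  · intro h
    rw [Set.mem_Ioo]
    by_contra hcon
    rw [not_and_or, not_lt, not_lt] at hcon
    refine absurd h (not_lt.2 ?_)
    rcases le_or_gt s l with h2 | h2
    · exact mul_nonpos_of_nonpos_of_nonneg
        (Real.sin_nonpos_of_nonpos_of_neg_pi_le (by nlinarith) (by nlinarith))
        (Real.sin_nonneg_of_nonneg_of_le_pi (by nlinarith) (by nlinarith))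
    · have h3 : r ≤ s := hcon.resolve_left (not_le.2 h2)
      exact mul_nonpos_of_nonneg_of_nonpos
        (Real.sin_nonneg_of_nonneg_of_le_pi (by nlinarith) (by nlinarith))
        (Real.sin_nonpos_of_nonpos_of_neg_pi_le (by nlinarith) (by nlinarith))
  · rintro ⟨h2, h3⟩
    exact mul_pos (Real.sin_pos_of_pos_of_lt_pi (by nlinarith) (by nlinarith))
      (Real.sin_pos_of_pos_of_lt_pi (by nlinarith) (by nlinarith))

namespace LiftGroup

/-- The inverse function theorem is applied to (s, t) ↦ (s, e s t), whose derivative is triangular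
with diagonal 1, 1 + sin s · b′(t). Joint smoothness in s and t is what later makes small s usable.
-/
theorem contDiff_symm_family {b : ℝ → ℝ} (hb : ContDiff ℝ ∞ b) {e : ℝ → (ℝ ≃o ℝ)}
    (he : ∀ s t, e s t = t + Real.sin s * b t)
    (hne : ∀ s t, 1 + Real.sin s * deriv b t ≠ 0) :
    ContDiff ℝ ∞ fun p : ℝ × ℝ => (e p.1).symm p.2 := by
  have hbd : ∀ t, HasDerivAt b (deriv b t) t := fun t =>
    (hb.differentiable (by simp)).differentiableAt.hasDerivAt
  let E : ℝ × ℝ ≃ ℝ × ℝ :=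
    { toFun := fun p => (p.1, e p.1 p.2)
      invFun := fun p => (p.1, (e p.1).symm p.2)
      left_inv := fun p => by simp
      right_inv := fun p => by simp }
  have hE_eq : (E : ℝ × ℝ → ℝ × ℝ) = fun q => (q.1, q.2 + Real.sin q.1 * b q.2) :=
    funext fun q => Prod.ext rfl (he q.1 q.2)
  have hE : ContDiff ℝ ∞ E := by
    rw [hE_eq]
    exact contDiff_fst.prodMk (contDiff_snd.add
      ((Real.contDiff_sin.comp contDiff_fst).mul (hb.comp contDiff_snd)))
  let E' : ℝ × ℝ → ((ℝ × ℝ) ≃L[ℝ] (ℝ × ℝ)) := fun p =>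
    (ContinuousLinearEquiv.refl ℝ ℝ).skewProd
      (ContinuousLinearEquiv.unitsEquivAut ℝ (Units.mk0 _ (hne p.1 p.2)))
      ((b p.2 * Real.cos p.1) • ContinuousLinearMap.id ℝ ℝ)
  have hE' : ∀ p, HasFDerivAt E (E' p : (ℝ × ℝ) →L[ℝ] (ℝ × ℝ)) p := by
    intro p
    have h1 : HasFDerivAt (fun q : ℝ × ℝ => Real.sin q.1)
        (Real.cos p.1 • ContinuousLinearMap.fst ℝ ℝ ℝ) p :=
      (Real.hasDerivAt_sin p.1).comp_hasFDerivAt p hasFDerivAt_fst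
    have h2 : HasFDerivAt (fun q : ℝ × ℝ => b q.2)
        (deriv b p.2 • ContinuousLinearMap.snd ℝ ℝ ℝ) p :=
      (hbd p.2).comp_hasFDerivAt p hasFDerivAt_snd
    have h3 : HasFDerivAt (fun q : ℝ × ℝ => (q.1, q.2 + Real.sin q.1 * b q.2)) _ p :=
      hasFDerivAt_fst.prodMk (hasFDerivAt_snd.add (h1.mul h2))
    rw [hE_eq]
    refine h3.congr_fderiv ?_
    ext <;> simp [E']
  have hopen : IsOpenMap E := isOpenMap_of_hasStrictFDerivAt_equiv fun p =>
    hE.contDiffAt.hasStrictFDerivAt' (hE' p) (by simp)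
  have hEsymm : ContDiff ℝ ∞ (E.toHomeomorphOfContinuousOpen hE.continuous hopen).symm :=
    (E.toHomeomorphOfContinuousOpen hE.continuous hopen).contDiff_symm hE' hE
  exact hEsymm.snd

/-- The factor sin s is a smooth bounded parameter, so the slope stays at least 1/2 for every real
s. -/
theorem exists_family_of_small {b : ℝ → ℝ} (hb : ContDiff ℝ ∞ b) (hper : Function.Periodic b 1)
    (hb0 : ∀ t, |b t| ≤ 1 / 2) (hb1 : ∀ t, |deriv b t| ≤ 1 / 2) :
    ∃ P : ℝ → LiftGroup, (∀ s t, P s t = t + Real.sin s * b t) ∧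
      ContDiff ℝ ∞ (fun p : ℝ × ℝ => P p.1 p.2) ∧
      ContDiff ℝ ∞ (fun p : ℝ × ℝ => (P p.1)⁻¹ p.2) := by
  have hsmall : ∀ s x : ℝ, |x| ≤ 1 / 2 → |Real.sin s * x| ≤ 1 / 2 := fun s x hx => by
    rw [abs_mul]
    nlinarith [Real.abs_sin_le_one s, abs_nonneg x, abs_nonneg (Real.sin s)]
  have hderiv : ∀ s t, HasDerivAt (fun t => t + Real.sin s * b t)
      (1 + Real.sin s * deriv b t) t := fun s t =>
    (hasDerivAt_id t).add
      ((hb.differentiable (by simp)).differentiableAt.hasDerivAt.const_mul (Real.sin s))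
  have hmono : ∀ s, StrictMono fun t => t + Real.sin s * b t := by
    intro s
    refine strictMono_of_deriv_pos fun t => ?_
    rw [(hderiv s t).deriv]
    linarith [(abs_le.1 (hsmall s _ (hb1 t))).1]
  have hsurj : ∀ s, Function.Surjective fun t => t + Real.sin s * b t := by
    intro s
    refine Continuous.surjective (continuous_id.add (continuous_const.mul hb.continuous)) ?_ ?_
    · refine tendsto_atTop_mono (f := fun t : ℝ => t + -(1 / 2)) (fun t => ?_)
        (tendsto_atTop_add_const_right _ _ tendsto_id)
      linarith [(abs_le.1 (hsmall s _ (hb0 t))).1]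
    · refine tendsto_atBot_mono (f := fun t : ℝ => t + 1 / 2) (fun t => ?_)
        (tendsto_atBot_add_const_right _ _ tendsto_id)
      linarith [(abs_le.1 (hsmall s _ (hb0 t))).2]
  obtain ⟨e, he⟩ : ∃ e : ℝ → (ℝ ≃o ℝ), ∀ s t, e s t = t + Real.sin s * b t :=
    ⟨fun s => (hmono s).orderIsoOfSurjective _ (hsurj s), fun _ _ => rfl⟩
  have hΦ : ContDiff ℝ ∞ fun p : ℝ × ℝ => e p.1 p.2 := by
    simp only [he]
    exact contDiff_snd.add ((Real.contDiff_sin.comp contDiff_fst).mul (hb.comp contDiff_snd))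
  have hΨ := contDiff_symm_family hb he fun s t h => by
    linarith [(abs_le.1 (hsmall s _ (hb1 t))).1]
  have hmem : ∀ s, e s ∈ liftSubgroup := fun s =>
    ⟨hΦ.comp (contDiff_const.prodMk contDiff_id : ContDiff ℝ ∞ fun t : ℝ => (s, t)),
      hΨ.comp (contDiff_const.prodMk contDiff_id : ContDiff ℝ ∞ fun t : ℝ => (s, t)),
      fun t => by rw [he, he, hper t]; ring⟩
  exact ⟨fun s => ⟨e s, hmem s⟩, he, hΦ, hΨ⟩

/-- A smooth periodic function generates a smooth family of diffeomorphisms. -/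
theorem exists_family {b : ℝ → ℝ} (hb : ContDiff ℝ ∞ b) (hper : Function.Periodic b 1) :
    ∃ c > 0, ∃ P : ℝ → LiftGroup, (∀ s t, P s t = t + Real.sin s * (c * b t)) ∧
      ContDiff ℝ ∞ (fun p : ℝ × ℝ => P p.1 p.2) ∧
      ContDiff ℝ ∞ (fun p : ℝ × ℝ => (P p.1)⁻¹ p.2) := by
  have hper' : Function.Periodic (deriv b) 1 := fun t => by
    rw [← deriv_comp_add_const]
    congr 1
    exact funext hper
  obtain ⟨M, hM⟩ := (hper.isBounded_of_continuous one_ne_zero hb.continuous).exists_norm_le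
  obtain ⟨M', hM'⟩ := (hper'.isBounded_of_continuous one_ne_zero
    (hb.continuous_deriv (by simp))).exists_norm_le
  have hM0 : ∀ t, |b t| ≤ M := fun t => hM _ ⟨t, rfl⟩
  have hM1 : ∀ t, |deriv b t| ≤ M' := fun t => hM' _ ⟨t, rfl⟩
  have hMn : 0 ≤ M := (abs_nonneg _).trans (hM0 0)
  have hMn' : 0 ≤ M' := (abs_nonneg _).trans (hM1 0)
  have hc : (0 : ℝ) < 1 / (2 * (M + M' + 1)) := by positivity
  refine ⟨1 / (2 * (M + M' + 1)), hc, exists_family_of_small (contDiff_const.mul hb)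
    (fun t => by simp only [hper t]) (fun t => ?_) fun t => ?_⟩
  · rw [abs_mul, abs_of_pos hc, div_mul_eq_mul_div, one_mul,
      div_le_div_iff₀ (by positivity) (by positivity)]
    linarith [hM0 t]
  · rw [deriv_const_mul_field, abs_mul, abs_of_pos hc, div_mul_eq_mul_div, one_mul,
      div_le_div_iff₀ (by positivity) (by positivity)]
    linarith [hM1 t]

theorem exists_contDiff_iteratedDeriv {U : ℝ × ℝ → ℝ} (hU : ContDiff ℝ ∞ U) (k : ℕ) :
    ∃ V : ℝ × ℝ → ℝ, ContDiff ℝ ∞ V ∧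
      ∀ s t, iteratedDeriv k (fun t => U (s, t)) t = V (s, t) := by
  induction k with
  | zero => exact ⟨U, hU, fun _ _ => by simp⟩
  | succ k ih =>
    obtain ⟨V, hV, h⟩ := ih
    refine ⟨fun p => fderiv ℝ V p (0, 1), ?_, fun s t => ?_⟩
    · exact (hV.fderiv_right (m := ∞) (by simp)).clm_apply contDiff_const
    · rw [iteratedDeriv_succ, funext (h s)]
      have h1 : HasDerivAt (fun t : ℝ => (s, t)) (0, 1) t :=
        (hasDerivAt_const t s).prodMk (hasDerivAt_id t)
      have h2 : HasFDerivAt V (fderiv ℝ V (s, t)) (s, t) :=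
        (hV.differentiable (by simp)).differentiableAt.hasFDerivAt
      exact (h2.comp_hasDerivAt t h1).deriv

/-- The derivatives in t are jointly continuous and vanish at s = 0; compactness of [0, 1] and
periodicity make the smallness uniform in t. -/
theorem eventually_nearOne {Q : ℝ → LiftGroup} (hQ : ContDiff ℝ ∞ fun p : ℝ × ℝ => Q p.1 p.2)
    (h0 : ∀ t, Q 0 t = t) (n : ℕ) : ∀ᶠ s in 𝓝 0, NearOne n (Q s) := by
  have hall : ∀ k ∈ Finset.range (n + 1), ∀ᶠ s in 𝓝 (0 : ℝ), ∀ t,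
      |iteratedDeriv k (fun t => Q s t - t) t| ≤ (1 / 2 : ℝ) ^ n := by
    intro k _
    obtain ⟨V, hV, hQV⟩ := exists_contDiff_iteratedDeriv (hQ.sub contDiff_snd) k
    have hzero : ∀ t, V (0, t) = 0 := by
      intro t
      rw [← hQV]
      simp [h0]
    have hloc : ∀ᶠ s in 𝓝 (0 : ℝ), ∀ t ∈ Set.Icc (0 : ℝ) 1, |V (s, t)| ≤ (1 / 2 : ℝ) ^ n := by
      refine isCompact_Icc.eventually_forall_of_forall_eventually fun t _ => ?_
      have hc : ContinuousAt (fun z : ℝ × ℝ => |V z|) (0, t) := hV.continuous.abs.continuousAt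
      have hlt : |V (0, t)| < (1 / 2 : ℝ) ^ n := by
        rw [hzero]
        simp
      filter_upwards [hc.eventually_lt_const hlt] with z hz
      exact hz.le
    filter_upwards [hloc] with s hs t
    have hper : Function.Periodic (iteratedDeriv k fun t => Q s t - t) 1 := by
      intro t
      have := congrFun (iteratedDeriv_comp_add_const k (fun t => Q s t - t) 1) t
      rw [← this]
      simp [map_add_one]
    rw [← hper.map_fract, hQV]
    exact hs _ ⟨Int.fract_nonneg t, (Int.fract_lt_one t).le⟩
  filter_upwards [(eventually_all_finset _).2 hall] with s hs k hk t
  exact hs k (Finset.mem_range.2 (by omega)) t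

theorem eventually_nearOne_conj {P : ℝ → LiftGroup}
    (hP : ContDiff ℝ ∞ fun p : ℝ × ℝ => P p.1 p.2) (h0 : ∀ t, P 0 t = t) (G : LiftGroup) (n : ℕ) :
    ∀ᶠ s in 𝓝 0, NearOne n (G * P s * G⁻¹) := by
  refine eventually_nearOne (Q := fun s => G * P s * G⁻¹) ?_ (fun t => ?_) n
  · exact G.contDiff.comp (hP.comp (contDiff_fst.prodMk (G⁻¹.contDiff.comp contDiff_snd)))
  · simp [h0]

theorem pow_apply (g : LiftGroup) (k : ℕ) (t : ℝ) : (g ^ k) t = g^[k] t := by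
  induction k generalizing t with
  | zero => rfl
  | succ k ih => rw [pow_succ, mul_apply, ih, Function.iterate_succ_apply]

/-- Iterates of a diffeomorphism moving points to the right converge to the next fixed point. -/
theorem tendsto_pow {g : LiftGroup} {l r : ℝ} (hg : ∀ t ∈ Set.Ioo l r, t < g t) (hr : g r = r)
    {t : ℝ} (ht : t ∈ Set.Ioo l r) : Tendsto (fun k => (g ^ k) t) atTop (𝓝 r) := by
  have hmem : ∀ k, (g ^ k) t ∈ Set.Ioo l r := by
    intro k
    induction k with
    | zero => exact ht
    | succ k ih =>
      rw [pow_succ', mul_apply]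
      exact ⟨ih.1.trans (hg _ ih), by rw [← hr]; exact g.strictMono (by simpa [hr] using ih.2)⟩
  have hmono : Monotone fun k => (g ^ k) t := monotone_nat_of_le_succ fun k => by
    rw [pow_succ', mul_apply]
    exact (hg _ (hmem k)).le
  have hlim := tendsto_atTop_ciSup hmono ⟨r, by rintro _ ⟨k, rfl⟩; exact (hmem k).2.le⟩
  set L := ⨆ k, (g ^ k) t
  -- The limit of an orbit is a fixed point, and there is none in (l, r).
  have hfix : g L = L := by
    have : Tendsto (fun k => g^[k] t) atTop (𝓝 L) := by simpa only [pow_apply] using hlim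
    exact isFixedPt_of_tendsto_iterate this g.contDiff.continuous.continuousAt
  have hLr : L ≤ r := le_of_tendsto' hlim fun k => (hmem k).2.le
  have hlL : l < L := ht.1.trans_le (hmono.ge_of_tendsto hlim 0)
  rcases hLr.lt_or_eq with h | h
  · exact absurd hfix (hg L ⟨hlL, h⟩).ne'
  · rwa [h] at hlim

end LiftGroup

/-! ### Moved arcs and the building blocks -/

namespace LiftGroup

/-- The points of the circle that are not fixed by the diffeomorphism. -/
def moved (f : LiftGroup) : Set UnitAddCircle := {p | f.toHomeo p ≠ p}

theorem isOpen_moved (f : LiftGroup) : IsOpen f.moved :=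
  isOpen_ne_fun f.toHomeo.continuous continuous_id

theorem coe_mem_moved {f : LiftGroup} (h0 : f 0 = 0) (t : ℝ) :
    (t : UnitAddCircle) ∈ f.moved ↔ f t ≠ t :=
  not_congr (toHomeo_coe_eq_iff h0 t)

/-- There is a diffeomorphism that moves precisely the points of an arc, all in the positive
direction. -/
theorem exists_push {l r : ℝ} (hl : 0 ≤ l) (hlr : l < r) (hr : r ≤ 1) :
    ∃ g : LiftGroup, ∀ t, (Int.fract t ∈ Set.Ioo l r → t < g t) ∧
      (Int.fract t ∉ Set.Ioo l r → g t = t) := by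
  obtain ⟨c, hc, P, hP, -, -⟩ := exists_family (contDiff_periodicBump l r) (periodic_periodicBump l r)
  have hsin : 0 < Real.sin 1 := Real.sin_pos_of_pos_of_lt_pi one_pos (by linarith [Real.pi_gt_three])
  refine ⟨P 1, fun t => ⟨fun ht => ?_, fun ht => ?_⟩⟩
  · rw [hP]
    have := (periodicBump_nonneg l r t).lt_of_ne' ((periodicBump_ne_zero_iff hl hlr hr t).2 ht)
    have : 0 < Real.sin 1 * (c * periodicBump l r t) := by positivity
    linarith
  · rw [hP, not_ne_iff.1 (mt (periodicBump_ne_zero_iff hl hlr hr t).1 ht)]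
    simp

theorem fract_eq_self_of_mem_Ioo {l r t : ℝ} (hl : 0 ≤ l) (hr : r ≤ 1) (ht : t ∈ Set.Ioo l r) :
    Int.fract t = t :=
  Int.fract_eq_self.2 ⟨hl.trans ht.1.le, ht.2.trans_le hr⟩

/-- For a conjugate of a diffeomorphism supported in an arc, the moved set is the image arc. -/
theorem moved_conj {F : LiftGroup} {a b : ℝ} (ha : 0 ≤ a) (hb : b ≤ 1)
    (hF : ∀ t, F t ≠ t ↔ Int.fract t ∈ Set.Ioo a b) (G : LiftGroup)
    (h0 : (G * F * G⁻¹) 0 = 0) :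
    (G * F * G⁻¹).moved = (fun t : ℝ => (t : UnitAddCircle)) '' Set.Ioo (G a) (G b) := by
  have hmoved : ∀ t, (G * F * G⁻¹) t ≠ t ↔ Int.fract (G⁻¹ t) ∈ Set.Ioo a b := by
    intro t
    rw [← hF, not_iff_not, mul_apply, mul_apply]
    refine ⟨fun h => ?_, fun h => by rw [h, apply_inv_self]⟩
    rw [← inv_apply_self G (F (G⁻¹ t)), h]
  ext p
  induction p using QuotientAddGroup.induction_on with
  | H t =>
  refine (coe_mem_moved h0 t).trans ((hmoved t).trans ⟨fun h => ?_, ?_⟩)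
  · refine ⟨t - ⌊G⁻¹ t⌋, ?_, ?_⟩
    · have : G (Int.fract (G⁻¹ t)) = t - ⌊G⁻¹ t⌋ := by
        have := G.map_add_int (G⁻¹ t) (-⌊G⁻¹ t⌋)
        rw [apply_inv_self] at this
        rw [Int.cast_neg] at this
        rw [Int.fract, sub_eq_add_neg, this, sub_eq_add_neg]
      rw [← this]
      exact ⟨G.strictMono h.1, G.strictMono h.2⟩
    · simp
  · rintro ⟨s, hs, hst⟩
    rw [← hmoved, ← coe_mem_moved h0, ← show (s : UnitAddCircle) = t from hst, coe_mem_moved h0,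
      hmoved]
    have : G⁻¹ s ∈ Set.Ioo a b := by
      constructor
      · rw [← inv_apply_self G a]
        exact G⁻¹.strictMono hs.1
      · rw [← inv_apply_self G b]
        exact G⁻¹.strictMono hs.2
    rwa [fract_eq_self_of_mem_Ioo ha hb this]

theorem diam_arc_le {a b : ℝ} (hab : a ≤ b) :
    Metric.diam ((fun t : ℝ => (t : UnitAddCircle)) '' Set.Ioo a b) ≤ b - a := by
  refine Metric.diam_le_of_forall_dist_le (sub_nonneg.2 hab) ?_
  rintro _ ⟨s, hs, rfl⟩ _ ⟨t, ht, rfl⟩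
  rw [dist_eq_norm, ← AddCircle.coe_sub]
  refine QuotientAddGroup.norm_mk_le_norm.trans ?_
  rw [Real.norm_eq_abs, abs_le]
  constructor <;> linarith [hs.1, hs.2, ht.1, ht.2]

theorem diam_arc_pos {a b : ℝ} (hab : a < b) (ha : 0 ≤ a) (hb : b ≤ 1) :
    0 < Metric.diam ((fun t : ℝ => (t : UnitAddCircle)) '' Set.Ioo a b) := by
  refine Metric.diam_pos ?_ (Metric.isBounded_of_compactSpace)
  refine (Set.Ioo_infinite hab).nontrivial.image_of_injOn ?_
  intro s hs t ht hst
  rw [← fract_eq_self_of_mem_Ioo ha hb hs, ← fract_eq_self_of_mem_Ioo ha hb ht]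
  obtain ⟨k, hk⟩ := AddSubgroup.mem_zmultiples_iff.1 (QuotientAddGroup.eq_iff_sub_mem.1 hst)
  rw [Int.fract_eq_fract]
  exact ⟨k, by simpa using hk.symm⟩

/-- The building blocks: for each `n` two conjugate diffeomorphisms `f n 0`, `f n 1`, close to the
identity, with supports in disjoint sets `A n` and moving the points of a single arc, the lengths
of all these arcs decreasing superexponentially. -/
theorem exists_blocks : ∃ (A : ℕ → Set ℝ) (f : ℕ → ZMod 2 → LiftGroup) (H : ℕ → LiftGroup)
    (e : ℕ → ℝ), Pairwise (Function.onFun Disjoint A) ∧ (∀ n, (0 : ℝ) ∉ A n) ∧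
      (∀ n c, ∀ t ∉ A n, f n c t = t) ∧ (∀ n, ∀ t ∉ A n, H n t = t) ∧
      (∀ n, f n 1 = H n * f n 0 * (H n)⁻¹) ∧
      (∀ n c, NearOne n (f n c) ∧ NearOne n (f n c)⁻¹) ∧
      (∀ n c, IsPreconnected (f n c).moved ∧ Metric.diam (f n c).moved = e (2 * n + c.val)) ∧
      (∀ j, 0 < e j) ∧ e 0 ≤ 1 / 2 ∧ ∀ j, e (j + 1) ≤ e j ^ (j + 1) := by
  let u : ℕ → ℝ := fun n => 1 / ((n : ℝ) + 1)
  have hu0 : ∀ n, 0 < u n := fun n => Nat.one_div_pos_of_nat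
  have hu1 : ∀ n, u n ≤ 1 := fun n => by
    have := Nat.one_div_le_one_div (α := ℝ) (Nat.zero_le n)
    simpa [u] using this
  have hlt : ∀ n, u (n + 1) < u n := fun n => Nat.one_div_lt_one_div (Nat.lt_succ_self n)
  have hanti : Antitone u := antitone_nat_of_succ_le fun n => (hlt n).le
  choose b hb using fun n => exists_between (hlt n)
  choose a ha using fun n => exists_between (hb n).1
  choose g hg using fun n => exists_push (hu0 (n + 1)).le (hlt n) (hu1 n)
  let A : ℕ → Set ℝ := fun n => {t | Int.fract t ∈ Set.Ioo (u (n + 1)) (u n)}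
  have hAm : ∀ n t, t ∈ Set.Ioo (u (n + 1)) (u n) → Int.fract t = t := fun n t ht =>
    fract_eq_self_of_mem_Ioo (hu0 _).le (hu1 n) ht
  have hgpow : ∀ n k, ∀ t ∉ A n, (g n ^ k) t = t := by
    intro n k t ht
    rw [pow_apply]
    exact Function.iterate_fixed ((hg n t).2 ht) k
  have hrA : ∀ n, u n ∉ A n := fun n hn => by
    have h1 : Int.fract (u n) ∈ Set.Ioo (u (n + 1)) (u n) := hn
    rcases (hu1 n).lt_or_eq with h | h
    · rw [Int.fract_eq_self.2 ⟨(hu0 n).le, h⟩] at h1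
      exact lt_irrefl _ h1.2
    · rw [h, Int.fract_one] at h1
      exact absurd h1.1 (not_lt.2 (hu0 _).le)
  have hlA : ∀ n, u (n + 1) ∉ A n := fun n hn => by
    have h1 : Int.fract (u (n + 1)) ∈ Set.Ioo (u (n + 1)) (u n) := hn
    rw [Int.fract_eq_self.2 ⟨(hu0 _).le, (hlt n).trans_le (hu1 n)⟩] at h1
    exact lt_irrefl _ h1.1
  have h0A : ∀ n, (0 : ℝ) ∉ A n := fun n hn => by
    have h1 : Int.fract (0 : ℝ) ∈ Set.Ioo (u (n + 1)) (u n) := hn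
    rw [Int.fract_zero] at h1
    exact absurd h1.1 (not_lt.2 (hu0 _).le)
  have haI : ∀ n, a n ∈ Set.Ioo (u (n + 1)) (u n) := fun n => ⟨(ha n).1, (ha n).2.trans (hb n).2⟩
  have hbI : ∀ n, b n ∈ Set.Ioo (u (n + 1)) (u n) := fun n => ⟨(hb n).1, (hb n).2⟩
  have hgI : ∀ n k, ∀ t ∈ Set.Ioo (u (n + 1)) (u n),
      (g n ^ k) t ∈ Set.Ioo (u (n + 1)) (u n) := fun n k t ht =>
    ⟨by rw [← hgpow n k _ (hlA n)]; exact (g n ^ k).strictMono ht.1,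
      by rw [← hgpow n k _ (hrA n)]; exact (g n ^ k).strictMono ht.2⟩
  let arc : ℕ → ℕ → Set UnitAddCircle := fun n k =>
    (fun t : ℝ => (t : UnitAddCircle)) '' Set.Ioo ((g n ^ k) (a n)) ((g n ^ k) (b n))
  -- Index j = 2n + c stands for interval n = j / 2 and bit c. Powers of g n push (a n, b n) towards
  -- the fixed endpoint u n, so its image shrinks to a point.
  obtain ⟨K, hK0, hK⟩ := exists_superexponential_choice
    (D := fun j k => Metric.diam (arc (j / 2) k))
    (fun j k => diam_arc_pos ((g (j / 2) ^ k).strictMono (ha _).2)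
      ((hu0 _).le.trans (hgI _ k _ (haI _)).1.le) ((hgI _ k _ (hbI _)).2.le.trans (hu1 _)))
    (fun j => by
      have hlim : ∀ t ∈ Set.Ioo (u (j / 2 + 1)) (u (j / 2)),
          Tendsto (fun k => (g (j / 2) ^ k) t) atTop (𝓝 (u (j / 2))) := fun t ht =>
        tendsto_pow (fun s hs => (hg _ s).1 ((hAm _ s hs).symm ▸ hs)) ((hg _ _).2 (hrA _)) ht
      have hsub := (hlim _ (hbI _)).sub (hlim _ (haI _))
      rw [sub_self] at hsub
      exact squeeze_zero (fun _ => Metric.diam_nonneg)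
        (fun k => diam_arc_le ((g (j / 2) ^ k).strictMono (ha _).2).le) hsub)
  choose c hc P hP hPc hPc' using fun n =>
    exists_family (contDiff_periodicBump (a n) (b n)) (periodic_periodicBump (a n) (b n))
  let G : ℕ → ZMod 2 → LiftGroup := fun n i => g n ^ K (2 * n + i.val)
  have hP0 : ∀ n t, P n 0 t = t := fun n t => by simp [hP]
  have hP0' : ∀ n t, (P n 0)⁻¹ t = t := fun n t => by
    conv_lhs => rw [← hP0 n t]
    exact inv_apply_self _ _
  -- The parameter s is chosen after K: conjugation by a high power may inflate derivatives, but
  -- both conjugates tend to the identity as s → 0.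
  have hs : ∀ n, ∃ s, 0 < Real.sin s ∧ ∀ i, NearOne n (G n i * P n s * (G n i)⁻¹) ∧
      NearOne n (G n i * P n s * (G n i)⁻¹)⁻¹ := by
    intro n
    have h1 : ∀ᶠ s in 𝓝 (0 : ℝ), ∀ i : ZMod 2, NearOne n (G n i * P n s * (G n i)⁻¹) ∧
        NearOne n (G n i * (P n s)⁻¹ * (G n i)⁻¹) := eventually_all.2 fun i =>
      (eventually_nearOne_conj (hPc n) (hP0 n) (G n i) n).and
        (eventually_nearOne_conj (P := fun s => (P n s)⁻¹) (hPc' n) (hP0' n) (G n i) n)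
    have h2 : ∀ᶠ s in 𝓝[>] (0 : ℝ), 0 < Real.sin s := by
      filter_upwards [Ioo_mem_nhdsGT Real.pi_pos] with s hs
      exact Real.sin_pos_of_pos_of_lt_pi hs.1 hs.2
    obtain ⟨s, hs1, hs2⟩ := ((h1.filter_mono nhdsWithin_le_nhds).and h2).exists
    refine ⟨s, hs2, fun i => ⟨(hs1 i).1, ?_⟩⟩
    have := (hs1 i).2
    rwa [show (G n i * P n s * (G n i)⁻¹)⁻¹ = G n i * (P n s)⁻¹ * (G n i)⁻¹ by group]
  choose s hs0 hs using hs
  have hmove : ∀ n t, P n (s n) t ≠ t ↔ Int.fract t ∈ Set.Ioo (a n) (b n) := by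
    intro n t
    rw [← periodicBump_ne_zero_iff ((hu0 _).le.trans (haI n).1.le) (ha n).2
      ((hbI n).2.le.trans (hu1 n)), hP, Ne, add_eq_left, mul_eq_zero, mul_eq_zero]
    simp [(hs0 n).ne', (hc n).ne']
  have hPA : ∀ n, ∀ t ∉ A n, P n (s n) t = t := by
    intro n t ht
    by_contra h
    have := (hmove n t).1 h
    exact ht ⟨(haI n).1.trans this.1, this.2.trans (hbI n).2⟩
  have hGA : ∀ n i, ∀ t ∉ A n, (G n i)⁻¹ t = t := fun n i t ht => by
    conv_lhs => rw [← hgpow n (K (2 * n + i.val)) t ht]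
    exact inv_apply_self _ _
  have hfA : ∀ n i, ∀ t ∉ A n, (G n i * P n (s n) * (G n i)⁻¹) t = t := fun n i t ht => by
    rw [mul_apply, mul_apply, hGA n i t ht, hPA n t ht]
    exact hgpow _ _ t ht
  have hmoved : ∀ n i, (G n i * P n (s n) * (G n i)⁻¹).moved = arc n (K (2 * n + i.val)) :=
    fun n i => moved_conj ((hu0 _).le.trans (haI n).1.le) ((hbI n).2.le.trans (hu1 n)) (hmove n) _
      (hfA n i 0 (h0A n))
  refine ⟨A, fun n i => G n i * P n (s n) * (G n i)⁻¹, fun n => G n 1 * (G n 0)⁻¹,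
    fun j => Metric.diam (arc (j / 2) (K j)), ?_, h0A, hfA, ?_, ?_, hs, ?_, ?_, hK0, hK⟩
  · intro n m hnm
    exact (hanti.pairwise_disjoint_on_Ioo_succ hnm).preimage Int.fract
  · intro n t ht
    rw [mul_apply, hGA n 0 t ht]
    exact hgpow _ _ t ht
  · intro n
    group
  · intro n i
    rw [hmoved]
    refine ⟨isPreconnected_Ioo.image _ (AddCircle.continuous_mk' 1).continuousOn, ?_⟩
    have : (2 * n + i.val) / 2 = n := by have := ZMod.val_lt i; omega
    simp only [this]
  · exact fun j => diam_arc_pos ((g (j / 2) ^ K j).strictMono (ha _).2)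
      ((hu0 _).le.trans (hgI _ _ _ (haI _)).1.le) ((hgI _ _ _ (hbI _)).2.le.trans (hu1 _))

end LiftGroup

/-! ### Hölder non-conjugacy of complementary points -/

/-- The components of a disjoint union of open connected sets are these sets. -/
theorem connectedComponentIn_iUnion_of_disjoint {X ι : Type*} [TopologicalSpace X]
    {U : ι → Set X} (ho : ∀ i, IsOpen (U i)) (hc : ∀ i, IsPreconnected (U i))
    (hd : Pairwise (Function.onFun Disjoint U)) {i : ι} {p : X} (hp : p ∈ U i) :
    connectedComponentIn (⋃ j, U j) p = U i := by
  have hpU : p ∈ ⋃ j, U j := Set.mem_iUnion.2 ⟨i, hp⟩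
  refine Set.Subset.antisymm ?_ ((hc i).subset_connectedComponentIn hp (Set.subset_iUnion U i))
  refine IsPreconnected.subset_left_of_subset_union (ho i)
    (isOpen_iUnion fun j => isOpen_iUnion fun _ : j ≠ i => ho j) ?_ ?_
    ⟨p, mem_connectedComponentIn hpU, hp⟩ isPreconnected_connectedComponentIn
  · exact Set.disjoint_iUnion_right.2 fun j => Set.disjoint_iUnion_right.2 fun hj => (hd hj).symm
  · refine (connectedComponentIn_subset _ _).trans (Set.iUnion_subset fun j => ?_)
    by_cases hj : j = i
    · exact hj ▸ Set.subset_union_left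
    · exact (Set.subset_iUnion₂ (s := fun j (_ : j ≠ i) => U j) j hj).trans
        Set.subset_union_right

theorem HolderWith.diam_image_le {X Y : Type*} [PseudoMetricSpace X] [CompactSpace X]
    [PseudoMetricSpace Y] {C r : ℝ≥0} {f : X → Y} (hf : HolderWith C r f) (s : Set X) :
    Metric.diam (f '' s) ≤ C * Metric.diam s ^ (r : ℝ) := by
  have hs : Metric.ediam s ≠ ⊤ := Metric.isBounded_of_compactSpace.ediam_ne_top
  have := ENNReal.toReal_mono (ENNReal.mul_ne_top ENNReal.coe_ne_top
    (ENNReal.rpow_ne_top_of_nonneg r.2 hs)) (hf.ediam_image_le s)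
  rwa [ENNReal.toReal_mul, ← ENNReal.toReal_rpow, ENNReal.coe_toReal] at this

namespace LiftGroup

variable {A : ℕ → Set ℝ} {f : ℕ → ZMod 2 → LiftGroup} {F : (ℕ → ZMod 2) → LiftGroup}

theorem moved_disjoint (hA : Pairwise (Function.onFun Disjoint A)) (h0 : ∀ n, (0 : ℝ) ∉ A n)
    (hfA : ∀ n c, ∀ t ∉ A n, f n c t = t) (x : ℕ → ZMod 2) :
    Pairwise (Function.onFun Disjoint fun n => (f n (x n)).moved) := by
  intro n m hnm
  refine Set.disjoint_left.2 fun p hn hm => ?_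
  induction p using QuotientAddGroup.induction_on with
  | H t =>
  have h1 := (coe_mem_moved (hfA n _ 0 (h0 n)) t).1 hn
  have h2 := (coe_mem_moved (hfA m _ 0 (h0 m)) t).1 hm
  exact Set.disjoint_left.1 (hA hnm) (not_not.1 (mt (hfA n _ t) h1)) (not_not.1 (mt (hfA m _ t) h2))

theorem moved_glue (hA : Pairwise (Function.onFun Disjoint A)) (h0 : ∀ n, (0 : ℝ) ∉ A n)
    (hfA : ∀ n c, ∀ t ∉ A n, f n c t = t)
    (hF : ∀ x t, F x t = glueFun (fun n => f n (x n)) t) (x : ℕ → ZMod 2) :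
    (F x).moved = ⋃ n, (f n (x n)).moved := by
  have hsupp : SupportedIn A fun n => f n (x n) := fun n t => hfA n _ t
  have hF0 : F x 0 = 0 := by rw [hF, hsupp.glueFun_of_notMem h0]
  ext p
  induction p using QuotientAddGroup.induction_on with
  | H t =>
  refine (coe_mem_moved hF0 t).trans (Iff.trans ?_ Set.mem_iUnion.symm)
  have hmem : ∀ n, ((t : UnitAddCircle) ∈ (f n (x n)).moved ↔ f n (x n) t ≠ t) := fun n =>
    coe_mem_moved (hfA n _ 0 (h0 n)) t
  refine Iff.trans ?_ (exists_congr hmem).symm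
  constructor
  · intro h
    by_cases ht : ∃ n, t ∈ A n
    · obtain ⟨n, hn⟩ := ht
      rw [hF, hsupp.glueFun_of_mem hA hn] at h
      exact ⟨n, h⟩
    · rw [hF, hsupp.glueFun_of_notMem (not_exists.1 ht)] at h
      exact absurd rfl h
  · rintro ⟨n, hn⟩
    rwa [hF, hsupp.glueFun_of_mem hA (not_not.1 (mt (hfA n _ t) hn))]

/-- H n conjugates the n-th block to its partner and is the identity on the other supports. -/
theorem glue_add_single (hA : Pairwise (Function.onFun Disjoint A))
    (hfA : ∀ n c, ∀ t ∉ A n, f n c t = t) {H : ℕ → LiftGroup} (hHA : ∀ n, ∀ t ∉ A n, H n t = t)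
    (hH : ∀ n, f n 1 = H n * f n 0 * (H n)⁻¹)
    (hF : ∀ x t, F x t = glueFun (fun n => f n (x n)) t) {x : ℕ → ZMod 2} {n : ℕ} (hx : x n = 0)
    (t : ℝ) : F (x + Pi.single n 1) t = H n (F x ((H n)⁻¹ t)) := by
  have hsupp : ∀ y : ℕ → ZMod 2, SupportedIn A fun n => f n (y n) := fun y n t => hfA n _ t
  have hH' : SupportedIn A H := hHA
  by_cases ht : ∃ m, t ∈ A m
  · obtain ⟨m, hm⟩ := ht
    rw [hF, (hsupp _).glueFun_of_mem hA hm]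
    by_cases hmn : m = n
    · subst hmn
      have hm' : (H m)⁻¹ t ∈ A m := hH'.inv.map_mem hm
      rw [hF, (hsupp x).glueFun_of_mem hA hm', hx, Pi.add_apply, Pi.single_eq_same, hx, zero_add,
        hH]
      rfl
    · have hnot : ∀ s ∈ A m, s ∉ A n := fun s hs => Set.disjoint_left.1 (hA hmn) hs
      have hm' : f m (x m) t ∈ A m := (hsupp x).map_mem hm
      rw [hH'.inv n t (hnot t hm), hF, (hsupp x).glueFun_of_mem hA hm,
        hHA n _ (hnot _ hm'), Pi.add_apply, Pi.single_eq_of_ne hmn, add_zero]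
  · have ht' := not_exists.1 ht
    rw [hF, (hsupp _).glueFun_of_notMem ht', hH'.inv n t (ht' n), hF,
      (hsupp _).glueFun_of_notMem ht', hHA n t (ht' n)]

/-- Sequences agreeing in the first N ≥ k coordinates give maps and inverses within 4 · 2⁻ᴺ in C^k.
-/
theorem continuous_toDiffeo_glue (hA : Pairwise (Function.onFun Disjoint A))
    (hfA : ∀ n c, ∀ t ∉ A n, f n c t = t)
    (hn : ∀ n c, NearOne n (f n c) ∧ NearOne n (f n c)⁻¹)
    (hF : ∀ x t, F x t = glueFun (fun n => f n (x n)) t)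
    (hF' : ∀ x t, (F x)⁻¹ t = glueFun (fun n => (f n (x n))⁻¹) t) :
    Continuous fun x => (F x).toDiffeo := by
  refine CircleDiffeo.continuous_of_tendsto_distK fun x k => ?_
  have hsupp : ∀ y : ℕ → ZMod 2, SupportedIn A fun n => f n (y n) := fun y n t => hfA n _ t
  have hle : ∀ N, k ≤ N → ∀ y : ℕ → ZMod 2, (∀ n < N, y n = x n) →
      CircleDiffeo.distK k (F x).toDiffeo (F y).toDiffeo ≤ 4 * (1 / 2 : ℝ) ^ N := by
    intro N hN y hy
    refine CircleDiffeo.distK_le (fun i hi => derivDist_le fun t => ?_) fun i hi => ?_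
    · simp only [hF]
      exact iteratedDeriv_glueFun_sub_le (hsupp x) hA (hsupp y) (fun n => (hn n _).1)
        (fun n => (hn n _).1) (fun n hnN => by rw [hy n hnN]) (hi.trans hN) t
    · rw [inv_toDiffeo, inv_toDiffeo]
      refine derivDist_le fun t => ?_
      simp only [hF']
      exact iteratedDeriv_glueFun_sub_le (hsupp x).inv hA (hsupp y).inv (fun n => (hn n _).2)
        (fun n => (hn n _).2) (fun n hnN => by rw [hy n hnN]) (hi.trans hN) t
  rw [Metric.tendsto_nhds]
  intro ε hε
  have hlim : Tendsto (fun N : ℕ => 4 * (1 / 2 : ℝ) ^ N) atTop (𝓝 (4 * 0)) :=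
    (tendsto_pow_atTop_nhds_zero_of_lt_one (by norm_num) (by norm_num)).const_mul 4
  rw [mul_zero] at hlim
  obtain ⟨N, hN, hkN⟩ := ((hlim.eventually_lt_const hε).and (eventually_ge_atTop k)).exists
  have hnear : ∀ᶠ y : ℕ → ZMod 2 in 𝓝 x, ∀ n ∈ Finset.range N, y n = x n :=
    (eventually_all_finset _).2 fun n _ =>
      ((continuous_apply n).tendsto x).eventually (p := fun c => c = x n) (by simp [nhds_discrete])
  filter_upwards [hnear] with y hy
  rw [Real.dist_0_eq_abs, abs_of_nonneg (CircleDiffeo.distK_nonneg _ _ _)]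
  exact (hle N hkN y fun n hn => hy n (Finset.mem_range.2 hn)).trans_lt hN

/-- A conjugacy maps moved set onto moved set, hence components onto components; these are the block
arcs. Hölder continuity of h alone, without its inverse, compares their diameters. -/
theorem not_areConjugate_add_one (hA : Pairwise (Function.onFun Disjoint A))
    (h0 : ∀ n, (0 : ℝ) ∉ A n) (hfA : ∀ n c, ∀ t ∉ A n, f n c t = t)
    (hF : ∀ x t, F x t = glueFun (fun n => f n (x n)) t) {e : ℕ → ℝ}
    (hmoved : ∀ n c, IsPreconnected (f n c).moved ∧ Metric.diam (f n c).moved = e (2 * n + c.val))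
    (hpos : ∀ j, 0 < e j) (he0 : e 0 ≤ 1 / 2) (hstep : ∀ j, e (j + 1) ≤ e j ^ (j + 1))
    {x : ℕ → ZMod 2} (hx : ∃ᶠ n in atTop, x n = 1) :
    ¬ CircleDiffeo.AreConjugate holderHomeos (F (x + 1)).toDiffeo (F x).toDiffeo := by
  rintro ⟨h, ⟨-, C, r, hr, -, hC⟩, hconj⟩
  have himage : h '' (F x).moved = (F (x + 1)).moved := by
    ext p
    rw [h.image_eq_preimage_symm, Set.mem_preimage]
    refine not_congr ?_
    have hp : (F (x + 1)).toHomeo p = h ((F x).toHomeo (h.symm p)) := hconj p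
    rw [hp]
    exact h.toEquiv.eq_symm_apply
  have hcomp : ∀ (y : ℕ → ZMod 2) n p, p ∈ (f n (y n)).moved →
      connectedComponentIn (F y).moved p = (f n (y n)).moved := by
    intro y n p hp
    rw [moved_glue hA h0 hfA hF]
    exact connectedComponentIn_iUnion_of_disjoint (U := fun n => (f n (y n)).moved)
      (fun n => isOpen_moved _) (fun n => (hmoved n _).1) (moved_disjoint hA h0 hfA y) hp
  have hne : ∀ n c, (f n c).moved.Nonempty := by
    intro n c
    by_contra hempty
    have := (hmoved n c).2
    rw [Set.not_nonempty_iff_eq_empty.1 hempty, Metric.diam_empty] at this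
    exact (hpos _).ne this
  have hmatch : ∀ m, ∃ a, h '' (f a (x a)).moved = (f m ((x + 1) m)).moved := by
    intro m
    obtain ⟨p, hp⟩ := hne m ((x + 1) m)
    have hpF : p ∈ (F (x + 1)).moved := by
      rw [moved_glue hA h0 hfA hF]
      exact Set.mem_iUnion.2 ⟨m, hp⟩
    rw [← himage] at hpF
    obtain ⟨q, hq, rfl⟩ := hpF
    have hq' := hq
    rw [moved_glue hA h0 hfA hF] at hq'
    obtain ⟨a, ha⟩ := Set.mem_iUnion.1 hq'
    exact ⟨a, by rw [← hcomp x a q ha, h.image_connectedComponentIn hq, himage, hcomp _ m _ hp]⟩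
  choose τ hτ using hmatch
  have hinj : Function.Injective τ := by
    intro m m' hmm
    by_contra hne'
    have heq : (f m ((x + 1) m)).moved = (f m' ((x + 1) m')).moved := by
      rw [← hτ, ← hτ, hmm]
    have hd := moved_disjoint hA h0 hfA (x + 1) hne'
    obtain ⟨p, hp⟩ := hne m ((x + 1) m)
    exact Set.disjoint_left.1 hd hp (heq.subset hp)
  refine not_holder_matching hpos he0 hstep hx hinj C r (by exact_mod_cast hr) fun m => ?_
  have := hC.diam_image_le (f (τ m) (x (τ m))).moved
  rwa [hτ, (hmoved _ _).2, (hmoved _ _).2] at this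

end LiftGroup

/-! ### Conclusion -/

theorem areConjugate_toDiffeo {𝒟 : Set (UnitAddCircle ≃ₜ UnitAddCircle)}
    (h_smooth : smoothDiffeos ⊆ 𝒟) {F G H : LiftGroup} (h : ∀ t, F t = H (G (H⁻¹ t))) :
    CircleDiffeo.AreConjugate 𝒟 F.toDiffeo G.toDiffeo := by
  refine ⟨H.toHomeo, h_smooth H.toHomeo_mem, fun p => ?_⟩
  induction p using QuotientAddGroup.induction_on with
  | H t => exact congrArg _ (h t)

theorem CircleDiffeo.AreConjugate.mono {𝒟 ℰ : Set (UnitAddCircle ≃ₜ UnitAddCircle)} (h : 𝒟 ⊆ ℰ)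
    {S T : CircleDiffeo} (hST : CircleDiffeo.AreConjugate 𝒟 S T) :
    CircleDiffeo.AreConjugate ℰ S T :=
  hST.imp fun _ hh => ⟨h hh.1, hh.2⟩

open LiftGroup in
/-- A degree of regularity between Hölder and `C^∞` enters through the collection `𝒟` of
orientation-preserving circle homeomorphisms that have it: all `C^∞` diffeomorphisms belong to
`𝒟`, and every member of `𝒟` is a Hölder homeomorphism. -/
theorem theoremA (𝒟 : Set (UnitAddCircle ≃ₜ UnitAddCircle))
    (h_smooth : smoothDiffeos ⊆ 𝒟) (h_holder : 𝒟 ⊆ holderHomeos) :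
    ¬ ∃ φ : CircleDiffeo → ℝ, IsCompleteBorelInvariant 𝒟 φ := by
  rintro ⟨φ, hφ, hinv⟩
  obtain ⟨A, f, H, e, hA, h0, hfA, hHA, hH, hn, hmoved, hpos, he0, hstep⟩ := exists_blocks
  choose F hF hF' using fun x : ℕ → ZMod 2 =>
    exists_glue (f := fun n => f n (x n)) (fun n t => hfA n _ t) hA (fun n => (hn n _).1)
      fun n => (hn n _).2
  have hcont := continuous_toDiffeo_glue hA hfA hn hF hF'
  obtain ⟨x, hx⟩ := exists_apply_add_one_eq (f := fun x => φ (F x).toDiffeo)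
    (hφ.comp hcont.measurable) fun n x => by
      have htwo : ∀ c : ZMod 2, c = 0 ∨ c = 1 := by decide
      rcases htwo (x n) with h | h
      · exact (hinv _ _).1 (areConjugate_toDiffeo h_smooth (glue_add_single hA hfA hHA hH hF h))
      · have hback : x + Pi.single n 1 + Pi.single n 1 = x := by
          rw [add_assoc, CharTwo.add_self_eq_zero, add_zero]
        refine ((hinv _ _).1 (areConjugate_toDiffeo h_smooth (H := H n) fun t => ?_)).symm
        have := glue_add_single hA hfA hHA hH hF (x := x + Pi.single n 1) (n := n)
          (by rw [Pi.add_apply, h, Pi.single_eq_same]; rfl) t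
        rwa [hback] at this
  have hcontra := fun {x : ℕ → ZMod 2} (hx : ∃ᶠ n in atTop, x n = 1) =>
    not_areConjugate_add_one hA h0 hfA hF hmoved hpos he0 hstep hx
  -- One of x and x + 1 takes the value 1 infinitely often; as x + 1 + 1 = x, the roles can be
  -- exchanged.
  by_cases hfreq : ∃ᶠ n in atTop, x n = 1
  · exact hcontra hfreq (((hinv _ _).2 hx).mono h_holder)
  · have htwo : ∀ c : ZMod 2, c ≠ 1 → c + 1 = 1 := by decide
    have hfreq' : ∃ᶠ n in atTop, (x + 1) n = 1 :=
      ((not_frequently.1 hfreq).mono fun n hn => htwo _ hn).frequently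
    refine hcontra hfreq' ?_
    rw [add_assoc, CharTwo.add_self_eq_zero, add_zero]
    exact ((hinv _ _).2 hx.symm).mono h_holder
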